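/- \textbf{Theorem (comparison).} Let $\overline M$ be a compact smooth surface with (possibly empty, possibly disconnected) boundary $\partial M$, and let $h$ be a Riemannian metric of class $C^2$ on $\overline M$ with Gauss curvature $K_h=0$. Let $n_h$ be the outer unit normal of $\partial M$, $k_h$ the geodesic curvature of $\partial M$ with respect to $n_h$ (so that $k=1$ for the boundary of the Euclidean unit disk), and $\Delta_h$ the Laplace--Beltrami operator. Let $0<T\le\infty$, let $\psi_1,\psi_2$ be continuous functions on $\partial M\times[0,T)$ with $\psi_1\le\psi_2$, and let $u_{01},u_{02}:\overline M\to\mathbb R$ satisfy $u_{01}\le u_{02}$. For $i=1,2$ consider the initial-boundary value problem \begin{align*} &u_t=e^{-2u}\Delta_h u-1 &&\text{in }\overline M\times[0,T),\\ &\tfrac{\partial}{\partial n_h}u+k_h=\psi_i e^{u} &&\text{on }\partial M\times[0,T),\\ &u|_{t=0}=u_{0i} &&\text{in }\overline M. \tag{$P_i$} \end{align*} Let $u_1,u_2:\overline M\times[0,T)\to\mathbb R$ be of class $C^{2,1}$ on $\overline M\times[0,T)$, that is, $u$, $u_t$ and the first and second space derivatives of $u$ exist and are continuous, up to $\partial M$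 and up to $t=0$. (a) If $u_i$ is a solution of $(P_i)$ for $i=1,2$, then $u_1\le u_2$ on $\overline M\times[0,T)$. (b) More generally, suppose that $u_1$ is a subsolution of $(P_1)$ and $u_2$ is a supersolution of $(P_2)$, i.e. $u_1$ satisfies the three relations of $(P_1)$ with every $=$ replaced by $\le$, and $u_2$ satisfies those of $(P_2)$ with every $=$ replaced by $\ge$. Then $u_1\le u_2$ on $\overline M\times[0,T)$. -/

import Mathlib

open Set
open scoped Manifold ContDiff

noncomputable section

namespace BoundarySurface

/-- The coordinate plane `ℝ²`.  Boundary charts take values in the half-plane `{y | 0 ≤ y 0}`,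
which is `Set.range (𝓡∂ 2)`; the boundary corresponds to `y 0 = 0`. -/
abbrev Plane : Type := EuclideanSpace ℝ (Fin 2)

/-- The `i`-th coordinate vector `e_i` of `ℝ²`. -/
def basisVec (i : Fin 2) : Plane := EuclideanSpace.single i (1 : ℝ)

/-- The partial derivative `∂_i f` of a function on the half-plane `{y | 0 ≤ y 0}`
(one-sided in the direction `e_0` at points with `y 0 = 0`). -/
def pderiv (i : Fin 2) (f : Plane → ℝ) (y : Plane) : ℝ :=
  fderivWithin ℝ f (range (𝓡∂ 2)) y (basisVec i)

/-! ### Riemannian quantities of a matrix field `G = (g_ij)` on the half-plane -/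

/-- The inverse metric `g^{ij}`. -/
def invCoeff (G : Plane → Matrix (Fin 2) (Fin 2) ℝ) (i j : Fin 2) (y : Plane) : ℝ :=
  (G y)⁻¹ i j

/-- The Christoffel symbols
`Γ^k_{ij} = ½ ∑_l g^{kl} (∂_i g_{jl} + ∂_j g_{il} - ∂_l g_{ij})`. -/
def christoffel (G : Plane → Matrix (Fin 2) (Fin 2) ℝ) (k i j : Fin 2) (y : Plane) : ℝ :=
  (1 / 2 : ℝ) * ∑ l, invCoeff G k l y *
    (pderiv i (fun z => G z j l) y + pderiv j (fun z => G z i l) y - pderiv l (fun z => G z i j) y)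

/-- The coefficients of the curvature tensor, `R(∂_i, ∂_j) ∂_k = ∑_l R^l_{kij} ∂_l`, with
`R^l_{kij} = ∂_i Γ^l_{jk} - ∂_j Γ^l_{ik} + ∑_m (Γ^l_{im} Γ^m_{jk} - Γ^l_{jm} Γ^m_{ik})`. -/
def riemannCoeff (G : Plane → Matrix (Fin 2) (Fin 2) ℝ) (l k i j : Fin 2) (y : Plane) : ℝ :=
  pderiv i (christoffel G l j k) y - pderiv j (christoffel G l i k) y +
    ∑ m, (christoffel G l i m y * christoffel G m j k y -
      christoffel G l j m y * christoffel G m i k y)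

/-- The Gauss curvature `K = g(R(∂_0, ∂_1) ∂_1, ∂_0) / det g`. -/
def gaussCoord (G : Plane → Matrix (Fin 2) (Fin 2) ℝ) (y : Plane) : ℝ :=
  (∑ l, G y l 0 * riemannCoeff G l 1 0 1 y) / (G y).det

/-- The Laplace-Beltrami operator `Δ f = ∑_{i,j} g^{ij} (∂_i ∂_j f - ∑_k Γ^k_{ij} ∂_k f)`. -/
def laplacianCoord (G : Plane → Matrix (Fin 2) (Fin 2) ℝ) (f : Plane → ℝ) (y : Plane) : ℝ :=
  ∑ i, ∑ j, invCoeff G i j y *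
    (pderiv i (pderiv j f) y - ∑ k, christoffel G k i j y * pderiv k f y)

/-- The components `n^i = - g^{i0} / √(g^{00})` of the outer unit normal of `{y 0 = 0}`
(that is, `n = - ∇ y⁰ / |∇ y⁰|`; the half-plane lies in `{y | 0 ≤ y 0}`). -/
def outerNormalCoord (G : Plane → Matrix (Fin 2) (Fin 2) ℝ) (i : Fin 2) (y : Plane) : ℝ :=
  -(invCoeff G i 0 y) / √(invCoeff G 0 0 y)

/-- The outer normal derivative `∂f/∂n = ∑_i n^i ∂_i f` on `{y 0 = 0}`. -/
def normalDerivCoord (G : Plane → Matrix (Fin 2) (Fin 2) ℝ) (f : Plane → ℝ) (y : Plane) : ℝ :=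
  ∑ i, outerNormalCoord G i y * pderiv i f y

/-- The geodesic curvature `k = g(∇_τ n, τ) = - g(n, ∇_τ τ)` of `{y 0 = 0}` with respect to the
outer unit normal `n`, where `τ = ∂_1 / |∂_1|`; that is,
`k = - g(n, ∇_{∂_1} ∂_1) / g_{11}`.  The boundary of the Euclidean unit disk has `k = 1`. -/
def geodCurvCoord (G : Plane → Matrix (Fin 2) (Fin 2) ℝ) (y : Plane) : ℝ :=
  -(∑ i, ∑ j, G y i j * outerNormalCoord G i y * christoffel G j 1 1 y) / G y 1 1

/-! ### Surfaces with boundary -/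

section Surface

variable {M : Type*} [TopologicalSpace M] [ChartedSpace (EuclideanHalfSpace 2) M]
  [IsManifold (𝓡∂ 2) ∞ M]

/-- The type of Riemannian metrics of class `C²` on a surface with boundary. -/
abbrev Metric (M : Type*) [TopologicalSpace M] [ChartedSpace (EuclideanHalfSpace 2) M]
    [IsManifold (𝓡∂ 2) ∞ M] : Type _ :=
  Bundle.ContMDiffRiemannianMetric (𝓡∂ 2) 2 Plane (fun x : M => TangentSpace (𝓡∂ 2) x)

/-- The coordinate vector field `∂_i` of the chart at `c`, at the point with coordinates `y`. -/
def coordVec (c : M) (i : Fin 2) (y : Plane) :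
    TangentSpace (𝓡∂ 2) ((extChartAt (𝓡∂ 2) c).symm y) :=
  mfderivWithin 𝓘(ℝ, Plane) (𝓡∂ 2) (extChartAt (𝓡∂ 2) c).symm (range (𝓡∂ 2)) y (basisVec i)

/-- The matrix `g_ij = h(∂_i, ∂_j)` of the metric `h` in the chart at `c`. -/
def metricCoeff (h : Metric M) (c : M) (y : Plane) : Matrix (Fin 2) (Fin 2) ℝ :=
  Matrix.of fun i j => h.inner ((extChartAt (𝓡∂ 2) c).symm y) (coordVec c i y) (coordVec c j y)

/-- The coordinate expression of a function `f` in the chart at `c`. -/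
def coordExpr (c : M) (f : M → ℝ) (y : Plane) : ℝ := f ((extChartAt (𝓡∂ 2) c).symm y)

/-- The Gauss curvature `K_h(p)`, computed in the chart at `c`
(its value does not depend on the chart around `p`). -/
def gaussCurv (h : Metric M) (c p : M) : ℝ :=
  gaussCoord (metricCoeff h c) (extChartAt (𝓡∂ 2) c p)

/-- The Laplacian `Δ_h f (p)`, computed in the chart at `c`
(its value does not depend on the chart around `p`). -/
def laplacian (h : Metric M) (f : M → ℝ) (c p : M) : ℝ :=
  laplacianCoord (metricCoeff h c) (coordExpr c f) (extChartAt (𝓡∂ 2) c p)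

/-- The outer normal derivative `∂f/∂n_h (p)` at a boundary point `p`, computed in the chart at `c`
(its value does not depend on the chart around `p`). -/
def normalDeriv (h : Metric M) (f : M → ℝ) (c p : M) : ℝ :=
  normalDerivCoord (metricCoeff h c) (coordExpr c f) (extChartAt (𝓡∂ 2) c p)

/-- The geodesic curvature `k_h(p)` of the boundary at a boundary point `p`, computed in the chart
at `c` (its value does not depend on the chart around `p`). -/
def geodCurv (h : Metric M) (c p : M) : ℝ :=
  geodCurvCoord (metricCoeff h c) (extChartAt (𝓡∂ 2) c p)

/-- `K_h = 0` on the whole surface. -/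
def IsFlat (h : Metric M) : Prop :=
  ∀ c : M, ∀ p ∈ (chartAt (EuclideanHalfSpace 2) c).source, gaussCurv h c p = 0

/-- The time interval `[0, T)`, where `0 < T ≤ ∞`. -/
def timeInterval (T : EReal) : Set ℝ := {t | 0 ≤ t ∧ (t : EReal) < T}

/-- The time derivative `u_t (p, t)` on `[0, T)` (one-sided at `t = 0`). -/
def timeDeriv (T : EReal) (u : M → ℝ → ℝ) (p : M) (t : ℝ) : ℝ :=
  derivWithin (u p) (timeInterval T) t

/-- `u ∈ C^{2,1}` on `M × [0, T)`: all of `u`, `u_t` and the first and second space derivatives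
exist and are continuous on `M × [0, T)`, up to the boundary and up to `t = 0`. -/
structure IsC21 (T : EReal) (u : M → ℝ → ℝ) : Prop where
  contMDiff_space : ∀ t ∈ timeInterval T, ContMDiff (𝓡∂ 2) 𝓘(ℝ, ℝ) 2 (fun p => u p t)
  differentiable_time : ∀ p, DifferentiableOn ℝ (u p) (timeInterval T)
  continuous : ContinuousOn (fun q : M × ℝ => u q.1 q.2) (univ ×ˢ timeInterval T)
  continuous_timeDeriv :
    ContinuousOn (fun q : M × ℝ => timeDeriv T u q.1 q.2) (univ ×ˢ timeInterval T)
  continuous_pderiv : ∀ (c : M) (i : Fin 2),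
    ContinuousOn (fun q : Plane × ℝ => pderiv i (coordExpr c fun p => u p q.2) q.1)
      ((extChartAt (𝓡∂ 2) c).target ×ˢ timeInterval T)
  continuous_pderiv2 : ∀ (c : M) (i j : Fin 2),
    ContinuousOn (fun q : Plane × ℝ => pderiv i (pderiv j (coordExpr c fun p => u p q.2)) q.1)
      ((extChartAt (𝓡∂ 2) c).target ×ˢ timeInterval T)

/-- `u` solves, on `M × [0, T)`, in local charts,
`u_t = e^{-2u} Δ_h u - 1` on `M`, `∂u/∂n_h + k_h = ψ e^u` on `∂M`, `u(·, 0) = u₀`.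
Only the values of `ψ` on `∂M × [0, T)` matter. -/
structure IsSolution (h : Metric M) (T : EReal) (ψ : M → ℝ → ℝ) (u₀ : M → ℝ) (u : M → ℝ → ℝ) :
    Prop where
  regular : IsC21 T u
  equation : ∀ c : M, ∀ p ∈ (chartAt (EuclideanHalfSpace 2) c).source, ∀ t ∈ timeInterval T,
    timeDeriv T u p t =
      Real.exp (-2 * u p t) * laplacian h (fun q => u q t) c p - 1
  boundary : ∀ c : M, ∀ p ∈ (chartAt (EuclideanHalfSpace 2) c).source,
    p ∈ (𝓡∂ 2).boundary M → ∀ t ∈ timeInterval T,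
    normalDeriv h (fun q => u q t) c p + geodCurv h c p = ψ p t * Real.exp (u p t)
  initial : ∀ p, u p 0 = u₀ p

/-- `u` is a subsolution of the initial-boundary value problem in `IsSolution`. -/
structure IsSubsolution (h : Metric M) (T : EReal) (ψ : M → ℝ → ℝ) (u₀ : M → ℝ)
    (u : M → ℝ → ℝ) : Prop where
  regular : IsC21 T u
  equation : ∀ c : M, ∀ p ∈ (chartAt (EuclideanHalfSpace 2) c).source, ∀ t ∈ timeInterval T,
    timeDeriv T u p t ≤
      Real.exp (-2 * u p t) * laplacian h (fun q => u q t) c p - 1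
  boundary : ∀ c : M, ∀ p ∈ (chartAt (EuclideanHalfSpace 2) c).source,
    p ∈ (𝓡∂ 2).boundary M → ∀ t ∈ timeInterval T,
    normalDeriv h (fun q => u q t) c p + geodCurv h c p ≤ ψ p t * Real.exp (u p t)
  initial : ∀ p, u p 0 ≤ u₀ p

/-- `u` is a supersolution of the initial-boundary value problem in `IsSolution`. -/
structure IsSupersolution (h : Metric M) (T : EReal) (ψ : M → ℝ → ℝ) (u₀ : M → ℝ)
    (u : M → ℝ → ℝ) : Prop where
  regular : IsC21 T u
  equation : ∀ c : M, ∀ p ∈ (chartAt (EuclideanHalfSpace 2) c).source, ∀ t ∈ timeInterval T,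
    timeDeriv T u p t ≥
      Real.exp (-2 * u p t) * laplacian h (fun q => u q t) c p - 1
  boundary : ∀ c : M, ∀ p ∈ (chartAt (EuclideanHalfSpace 2) c).source,
    p ∈ (𝓡∂ 2).boundary M → ∀ t ∈ timeInterval T,
    normalDeriv h (fun q => u q t) c p + geodCurv h c p ≥ ψ p t * Real.exp (u p t)
  initial : ∀ p, u p 0 ≥ u₀ p

end Surface

end BoundarySurface

end

namespace BoundarySurface

open Filter Topology Bundle

/-! ### Regularity and positivity of the metric coefficients in a chart -/

section Coefficients

variable {M : Type*} [TopologicalSpace M] [ChartedSpace (EuclideanHalfSpace 2) M]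
  [IsManifold (𝓡∂ 2) ∞ M]

/-! Suppose `w = u₁ - u₂` is positive somewhere. Each chart carries a positive `barrier` `g` on a
closed half-ball around its centre. Choose finitely many charts whose half-radius balls cover the
surface, and let `κ` be the maximum of `w / (exp (μ t) g)` over all of them and over `[0, t₀]`. This
compares `w` with `κ exp (μ t)` times the minimum of the local barriers, so no globally defined
comparison function is needed. On its own rim a barrier exceeds any other barrier inside that one's
half-radius ball (`barrier_lt_exp_two`, `exp_two_le_barrier`), so the maximum lies off the rim, and
there `w` touches `κ exp (μ t) g` from below. Time `0` is excluded because `w ≤ 0` initially.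

Touching is impossible (`exists_chart_barrier`). On `∂M` the curvature terms cancel and the boundary
conditions give `∂w/∂n ≤ C w`, whereas a large `A` makes `∂g/∂n > C g` (`exists_barrier`). In the
interior the equations give `w_t ≤ (C₁ + C₂ C₃) w` (`interior_inequality`), whereas touching forces
`w_t ≥ μ w`. The order of choices matters: first `A`, then `C₃`, which bounds `Δg / g`, then `μ`. -/

lemma contMDiffOn_coordVec (c : M) (i : Fin 2) :
    ContMDiffOn 𝓘(ℝ, Plane) (𝓡∂ 2).tangent 2
      (fun y => (⟨(extChartAt (𝓡∂ 2) c).symm y, coordVec c i y⟩ : TangentBundle (𝓡∂ 2) M))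
      (extChartAt (𝓡∂ 2) c).target := by
  -- Order 3, because the tangent map loses one derivative.
  have hsymm : ContMDiffOn 𝓘(ℝ, Plane) (𝓡∂ 2) 3 (extChartAt (𝓡∂ 2) c).symm
      (extChartAt (𝓡∂ 2) c).target := contMDiffOn_extChartAt_symm c
  have hu : UniqueMDiffOn 𝓘(ℝ, Plane) (extChartAt (𝓡∂ 2) c).target :=
    (uniqueDiffOn_extChartAt_target c).uniqueMDiffOn
  have htan := hsymm.contMDiffOn_tangentMapWithin (m := 2) (by norm_num) hu
  have hsec : ContMDiff 𝓘(ℝ, Plane) (𝓘(ℝ, Plane)).tangent 2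
      (fun y => (⟨y, basisVec i⟩ : TangentBundle 𝓘(ℝ, Plane) Plane)) := by
    intro y
    exact contMDiffWithinAt_vectorSpace_iff_contDiffWithinAt.2 contDiffWithinAt_const
  refine (htan.comp hsec.contMDiffOn (fun y hy => hy)).congr fun y hy => ?_
  have := mfderivWithin_subset (extChartAt_target_subset_range c) (hu y hy)
    (mdifferentiableWithinAt_extChartAt_symm hy)
  simp only [tangentMapWithin, coordVec, Function.comp_apply, this]

lemma contDiffOn_metricCoeff (h : Metric M) (c : M) (i j : Fin 2) :
    ContDiffOn ℝ 2 (fun y => metricCoeff h c y i j) (extChartAt (𝓡∂ 2) c).target := by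
  rw [← contMDiffOn_iff_contDiffOn]
  intro y hy
  have hsymm : ContMDiffOn 𝓘(ℝ, Plane) (𝓡∂ 2) 2 (extChartAt (𝓡∂ 2) c).symm
      (extChartAt (𝓡∂ 2) c).target := contMDiffOn_extChartAt_symm c
  have key : ContMDiffWithinAt 𝓘(ℝ, Plane) ((𝓡∂ 2).prod 𝓘(ℝ)) 2
      (fun y ↦ TotalSpace.mk' ℝ (E := Bundle.Trivial M ℝ) ((extChartAt (𝓡∂ 2) c).symm y)
        (h.inner ((extChartAt (𝓡∂ 2) c).symm y) (coordVec c i y) (coordVec c j y)))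
      (extChartAt (𝓡∂ 2) c).target y := by
    apply ContMDiffWithinAt.clm_bundle_apply₂ (F₁ := Plane) (F₂ := Plane)
    · exact ContMDiffAt.comp_contMDiffWithinAt y h.contMDiff.contMDiffAt (hsymm y hy)
    · exact contMDiffOn_coordVec c i y hy
    · exact contMDiffOn_coordVec c j y hy
  rw [contMDiffWithinAt_totalSpace] at key
  exact key.2

/-- This is the Gram matrix of the coordinate basis pushed forward by the derivative of the inverse
chart, which is injective. -/
lemma posDef_metricCoeff (h : Metric M) (c : M) {y : Plane}
    (hy : y ∈ (extChartAt (𝓡∂ 2) c).target) : (metricCoeff h c y).PosDef := by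
  obtain ⟨D, hD, hinj⟩ : ∃ D : Plane →L[ℝ] Plane,
      (∀ i, coordVec c i y = D (basisVec i)) ∧ Function.Injective D :=
    ⟨mfderivWithin 𝓘(ℝ, Plane) (𝓡∂ 2) (extChartAt (𝓡∂ 2) c).symm (range (𝓡∂ 2)) y,
      fun i => rfl, (isInvertible_mfderivWithin_extChartAt_symm hy).injective⟩
  obtain ⟨B, hB, hpos⟩ : ∃ B : Plane →L[ℝ] Plane →L[ℝ] ℝ,
      (∀ i j, metricCoeff h c y i j = B (D (basisVec i)) (D (basisVec j))) ∧
      ∀ v ≠ 0, 0 < B v v :=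
    ⟨h.inner ((extChartAt (𝓡∂ 2) c).symm y), fun i j => by rw [← hD, ← hD]; rfl,
      fun v hv => h.pos _ v hv⟩
  refine Matrix.PosDef.of_dotProduct_mulVec_pos ?_ ?_
  · ext i j
    exact h.symm _ _ _
  · intro x hx
    have hv : D (WithLp.toLp 2 x) ≠ 0 := by
      intro h0
      apply hx
      have : (WithLp.toLp 2 x : Plane) = 0 := hinj (h0.trans (map_zero _).symm)
      simpa using this
    have hsum : (WithLp.toLp 2 x : Plane) = x 0 • basisVec 0 + x 1 • basisVec 1 := by
      ext k
      fin_cases k <;> simp [basisVec]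
    have := hpos _ hv
    rw [hsum] at this
    simp only [map_add, map_smul, add_apply, smul_apply,
      smul_eq_mul] at this
    simp only [dotProduct, Matrix.mulVec, hB, Fin.sum_univ_two,
      Pi.star_apply, star_trivial]
    linarith

end Coefficients

/-! ### Differential operators on the half-plane and derivative tests at a maximum -/

section Coordinates

variable {G : Plane → Matrix (Fin 2) (Fin 2) ℝ} {f g : Plane → ℝ} {y : Plane}

lemma range_halfPlane : range (𝓡∂ 2) = {y : Plane | 0 ≤ y 0} :=
  range_modelWithCornersEuclideanHalfSpace 2

lemma _root_.ContDiffWithinAt.pderiv {m n : WithTop ℕ∞}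
    (hf : ContDiffWithinAt ℝ n f (range (𝓡∂ 2)) y) (hmn : m + 1 ≤ n) (hy : y ∈ range (𝓡∂ 2))
    (i : Fin 2) : ContDiffWithinAt ℝ m (pderiv i f) (range (𝓡∂ 2)) y :=
  (hf.fderivWithin_right (𝓡∂ 2).uniqueDiffOn hmn hy).clm_apply contDiffWithinAt_const

lemma _root_.ContDiffWithinAt.invCoeff {n : WithTop ℕ∞}
    (hG : ∀ i j, ContDiffWithinAt ℝ n (fun z => G z i j) (range (𝓡∂ 2)) y)
    (hdet : (G y).det ≠ 0) (i j : Fin 2) :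
    ContDiffWithinAt ℝ n (invCoeff G i j) (range (𝓡∂ 2)) y := by
  have hD : ContDiffWithinAt ℝ n (fun z => (G z).det) (range (𝓡∂ 2)) y := by
    simp only [Matrix.det_fin_two]
    exact ((hG 0 0).mul (hG 1 1)).sub ((hG 0 1).mul (hG 1 0))
  have hA : ContDiffWithinAt ℝ n (fun z => (G z).adjugate i j) (range (𝓡∂ 2)) y := by
    simp only [Matrix.adjugate_fin_two]
    fin_cases i <;> fin_cases j
    · exact hG 1 1
    · exact (hG 0 1).neg
    · exact (hG 1 0).neg
    · exact hG 0 0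
  refine ((hD.inv hdet).mul hA).congr_of_eventuallyEq (.of_forall fun z => ?_) ?_ <;>
  simp [BoundarySurface.invCoeff, Matrix.inv_def]

lemma contDiffWithinAt_christoffel
    (hG : ∀ i j, ContDiffWithinAt ℝ 1 (fun z => G z i j) (range (𝓡∂ 2)) y)
    (hdet : (G y).det ≠ 0) (hy : y ∈ range (𝓡∂ 2)) (k i j : Fin 2) :
    ContDiffWithinAt ℝ 0 (christoffel G k i j) (range (𝓡∂ 2)) y := by
  have hd : ∀ i j k, ContDiffWithinAt ℝ 0 (pderiv i fun z => G z j k) (range (𝓡∂ 2)) y :=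
    fun i j k => (hG j k).pderiv (by norm_num) hy i
  exact contDiffWithinAt_const.mul <| .sum fun l _ =>
    ((ContDiffWithinAt.invCoeff hG hdet k l).of_le zero_le_one).mul
      (((hd _ _ _).add (hd _ _ _)).sub (hd _ _ _))

lemma continuousWithinAt_laplacianCoord
    (hG : ∀ i j, ContDiffWithinAt ℝ 1 (fun z => G z i j) (range (𝓡∂ 2)) y)
    (hdet : (G y).det ≠ 0) (hf : ContDiffWithinAt ℝ 2 f (range (𝓡∂ 2)) y)
    (hy : y ∈ range (𝓡∂ 2)) :
    ContinuousWithinAt (laplacianCoord G f) (range (𝓡∂ 2)) y := by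
  refine ContDiffWithinAt.continuousWithinAt (𝕜 := ℝ) (n := 0) ?_
  refine ContDiffWithinAt.sum fun i _ => .sum fun j _ =>
    ((ContDiffWithinAt.invCoeff hG hdet i j).of_le zero_le_one).mul (.sub ?_ (.sum fun k _ => ?_))
  · exact (hf.pderiv (m := 1) (by norm_num) hy j).pderiv (by norm_num) hy i
  · exact (contDiffWithinAt_christoffel hG hdet hy k i j).mul
      (hf.pderiv (one_le_two.trans' (by norm_num)) hy k)

lemma pderiv_sub (hf : DifferentiableWithinAt ℝ f (range (𝓡∂ 2)) y)
    (hg : DifferentiableWithinAt ℝ g (range (𝓡∂ 2)) y) (hy : y ∈ range (𝓡∂ 2)) (i : Fin 2) :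
    pderiv i (fun z => f z - g z) y = pderiv i f y - pderiv i g y := by
  simp only [pderiv, fderivWithin_fun_sub ((𝓡∂ 2).uniqueDiffOn y hy) hf hg,
    sub_apply]

lemma pderiv_const_mul (hf : DifferentiableWithinAt ℝ f (range (𝓡∂ 2)) y)
    (hy : y ∈ range (𝓡∂ 2)) (a : ℝ) (i : Fin 2) :
    pderiv i (fun z => a * f z) y = a * pderiv i f y := by
  simp only [pderiv, fderivWithin_const_mul ((𝓡∂ 2).uniqueDiffOn y hy) hf a,
    smul_apply, smul_eq_mul]

lemma pderiv_congr (hfg : f =ᶠ[𝓝[range (𝓡∂ 2)] y] g) (hy : y ∈ range (𝓡∂ 2)) (i : Fin 2) :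
    pderiv i f y = pderiv i g y := by
  simp only [pderiv, hfg.fderivWithin_eq_of_mem hy]

lemma eventually_differentiableWithinAt (hf : ContDiffWithinAt ℝ 2 f (range (𝓡∂ 2)) y)
    (hy : y ∈ range (𝓡∂ 2)) :
    ∀ᶠ z in 𝓝[range (𝓡∂ 2)] y, DifferentiableWithinAt ℝ f (range (𝓡∂ 2)) z := by
  have := hf.eventually (by simp)
  rw [insert_eq_of_mem hy] at this
  exact this.mono fun z hz => hz.differentiableWithinAt (by simp)

lemma laplacianCoord_sub (hf : ContDiffWithinAt ℝ 2 f (range (𝓡∂ 2)) y)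
    (hg : ContDiffWithinAt ℝ 2 g (range (𝓡∂ 2)) y) (hy : y ∈ range (𝓡∂ 2)) :
    laplacianCoord G (fun z => f z - g z) y = laplacianCoord G f y - laplacianCoord G g y := by
  have h2 : ∀ i j, pderiv i (pderiv j fun z => f z - g z) y
      = pderiv i (pderiv j f) y - pderiv i (pderiv j g) y := fun i j => by
    rw [← pderiv_sub ((hf.pderiv (m := 1) (by norm_num) hy j).differentiableWithinAt (by simp))
      ((hg.pderiv (m := 1) (by norm_num) hy j).differentiableWithinAt (by simp)) hy i]
    refine pderiv_congr ?_ hy i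
    filter_upwards [eventually_differentiableWithinAt hf hy, eventually_differentiableWithinAt hg hy,
      self_mem_nhdsWithin] with z hz hz' hzr using pderiv_sub hz hz' hzr j
  have h1 : ∀ k, pderiv k (fun z => f z - g z) y = pderiv k f y - pderiv k g y := fun k =>
    pderiv_sub (hf.differentiableWithinAt (by simp)) (hg.differentiableWithinAt (by simp)) hy k
  simp only [laplacianCoord, h1, h2, ← Finset.sum_sub_distrib]
  refine Finset.sum_congr rfl fun i _ => Finset.sum_congr rfl fun j _ => ?_
  simp only [mul_sub, Finset.sum_sub_distrib]
  ring

lemma laplacianCoord_const_mul (hf : ContDiffWithinAt ℝ 2 f (range (𝓡∂ 2)) y)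
    (hy : y ∈ range (𝓡∂ 2)) (a : ℝ) :
    laplacianCoord G (fun z => a * f z) y = a * laplacianCoord G f y := by
  have h2 : ∀ i j, pderiv i (pderiv j fun z => a * f z) y = a * pderiv i (pderiv j f) y :=
    fun i j => by
    rw [← pderiv_const_mul
      ((hf.pderiv (m := 1) (by norm_num) hy j).differentiableWithinAt (by simp)) hy a i]
    refine pderiv_congr ?_ hy i
    filter_upwards [eventually_differentiableWithinAt hf hy, self_mem_nhdsWithin] with z hz hzr
      using pderiv_const_mul hz hzr a j
  have h1 : ∀ k, pderiv k (fun z => a * f z) y = a * pderiv k f y := fun k =>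
    pderiv_const_mul (hf.differentiableWithinAt (by simp)) hy a k
  simp only [laplacianCoord, h1, h2, Finset.mul_sum]
  refine Finset.sum_congr rfl fun i _ => Finset.sum_congr rfl fun j _ => ?_
  simp only [Fin.sum_univ_two]
  ring

lemma normalDerivCoord_sub (hf : DifferentiableWithinAt ℝ f (range (𝓡∂ 2)) y)
    (hg : DifferentiableWithinAt ℝ g (range (𝓡∂ 2)) y) (hy : y ∈ range (𝓡∂ 2)) :
    normalDerivCoord G (fun z => f z - g z) y
      = normalDerivCoord G f y - normalDerivCoord G g y := by
  simp only [normalDerivCoord, pderiv_sub hf hg hy, mul_sub, Finset.sum_sub_distrib]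

lemma normalDerivCoord_const_mul (hf : DifferentiableWithinAt ℝ f (range (𝓡∂ 2)) y)
    (hy : y ∈ range (𝓡∂ 2)) (a : ℝ) :
    normalDerivCoord G (fun z => a * f z) y = a * normalDerivCoord G f y := by
  simp only [normalDerivCoord, pderiv_const_mul hf hy, Finset.mul_sum]
  exact Finset.sum_congr rfl fun i _ => by ring

/-- The inner normal `-n` has nonnegative zeroth component, so it lies in the tangent cone of the
half-plane, and the derivative along it is nonpositive at a maximum. -/
lemma normalDerivCoord_nonneg_of_isLocalMaxOn (hmax : IsLocalMaxOn f (range (𝓡∂ 2)) y)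
    (hy : y ∈ range (𝓡∂ 2)) (hG : 0 ≤ invCoeff G 0 0 y) : 0 ≤ normalDerivCoord G f y := by
  set v : Plane := -∑ i, outerNormalCoord G i y • basisVec i with hv
  have hv0 : 0 ≤ v 0 := by
    have : v 0 = invCoeff G 0 0 y / √(invCoeff G 0 0 y) := by
      simp [hv, basisVec, outerNormalCoord, neg_div]
    rw [this]
    positivity
  have hmem : v ∈ posTangentConeAt (range (𝓡∂ 2)) y := by
    apply mem_posTangentConeAt_of_segment_subset
    rintro z ⟨a, b, ha, hb, hab, rfl⟩
    rw [range_halfPlane] at hy ⊢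
    have hy' : 0 ≤ y 0 := hy
    simp only [mem_ofPred_eq, PiLp.add_apply, PiLp.smul_apply, smul_eq_mul]
    positivity
  have := hmax.fderivWithin_nonpos hmem
  simp only [hv, map_neg, map_sum, map_smul, smul_eq_mul] at this
  simpa only [normalDerivCoord, pderiv, Left.neg_nonpos_iff] using this

lemma _root_.IsLocalMax.fderiv_fderiv_nonpos (hmax : IsLocalMax f y) (hf : ContDiffAt ℝ 2 f y)
    (v : Plane) : fderiv ℝ (fderiv ℝ f) y v v ≤ 0 := by
  have hline : ∀ s : ℝ, HasDerivAt (fun s : ℝ => y + s • v) v s := fun s => by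
    simpa using ((hasDerivAt_id s).smul_const v).const_add y
  have hcont : Tendsto (fun s : ℝ => y + s • v) (𝓝 0) (𝓝 y) := by
    simpa using (hline 0).continuousAt.tendsto
  have hd : deriv (fun s : ℝ => f (y + s • v)) =ᶠ[𝓝 0] fun s => fderiv ℝ f (y + s • v) v := by
    filter_upwards [hcont.eventually (hf.eventually (by simp))] with s hs
    exact ((hs.differentiableAt (by simp)).hasFDerivAt.comp_hasDerivAt s (hline s)).deriv
  have hdd : deriv (deriv fun s : ℝ => f (y + s • v)) 0 = fderiv ℝ (fderiv ℝ f) y v v := by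
    rw [hd.deriv_eq]
    have h1 : HasFDerivAt (fderiv ℝ f) (fderiv ℝ (fderiv ℝ f) y) y :=
      ((hf.fderiv_right (m := 1) (by norm_num)).differentiableAt (by simp)).hasFDerivAt
    have h2 : HasFDerivAt (fun z => fderiv ℝ f z v) ((fderiv ℝ (fderiv ℝ f) y).flip v) y :=
      ((ContinuousLinearMap.apply ℝ ℝ v).hasFDerivAt.comp y h1)
    have h3 : HasDerivAt (fun s : ℝ => fderiv ℝ f (y + s • v) v)
        ((fderiv ℝ (fderiv ℝ f) y).flip v v) 0 :=
      h2.comp_hasDerivAt_of_eq 0 (hline 0) (by simp)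
    exact h3.deriv
  have hmax' : IsLocalMax (fun s : ℝ => f (y + s • v)) 0 := by
    simpa [IsLocalMax, IsMaxFilter] using hcont.eventually hmax
  -- A positive second derivative would make `0` a local minimum as well, hence the restriction to
  -- the line locally constant and its second derivative zero.
  by_contra! hpos
  have hcont0 : ContinuousAt (fun s : ℝ => f (y + s • v)) 0 := by
    have : ContinuousAt f (y + (0 : ℝ) • v) := by simpa using hf.continuousAt
    exact ContinuousAt.comp (g := f) this (hline 0).continuousAt
  have hmin := isLocalMin_of_deriv_deriv_pos (hdd ▸ hpos) hmax'.deriv_eq_zero hcont0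
  have hconst : (fun s : ℝ => f (y + s • v)) =ᶠ[𝓝 0] fun _ => f (y + (0 : ℝ) • v) := by
    filter_upwards [hmin, hmax'] with s h1 h2 using le_antisymm h2 h1
  have h0 := hconst.deriv.deriv_eq
  simp only [deriv_const', hdd] at h0
  exact hpos.ne' h0

lemma laplacianCoord_nonpos_of_isLocalMaxOn (hmax : IsLocalMaxOn f (range (𝓡∂ 2)) y)
    (hf : ContDiffWithinAt ℝ 2 f (range (𝓡∂ 2)) y) (hy : range (𝓡∂ 2) ∈ 𝓝 y)
    (hG : (G y).PosDef) : laplacianCoord G f y ≤ 0 := by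
  replace hmax : IsLocalMax f y := by rwa [IsLocalMaxOn, nhdsWithin_eq_nhds.2 hy] at hmax
  replace hf : ContDiffAt ℝ 2 f y := hf.contDiffAt hy
  have hev : ∀ᶠ z in 𝓝 y, ∀ j, pderiv j f z = fderiv ℝ f z (basisVec j) := by
    filter_upwards [eventually_mem_nhds_iff.2 hy] with z hz j
    rw [pderiv, fderivWithin_of_mem_nhds hz]
  have h1 : ∀ k, pderiv k f y = 0 := fun k => by
    rw [hev.self_of_nhds k, hmax.fderiv_eq_zero]; rfl
  have h2 : ∀ i j, pderiv i (pderiv j f) y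
      = fderiv ℝ (fderiv ℝ f) y (basisVec i) (basisVec j) := fun i j => by
    have hd : DifferentiableAt ℝ (fderiv ℝ f) y :=
      (hf.fderiv_right (m := 1) (by norm_num)).differentiableAt (by simp)
    have he : pderiv j f =ᶠ[𝓝 y] fun z => fderiv ℝ f z (basisVec j) := hev.mono fun z hz => hz j
    rw [pderiv, fderivWithin_of_mem_nhds hy, he.fderiv_eq]
    simp [fderiv_clm_apply hd (differentiableAt_const _)]
  have hP := hG.inv
  have ha : 0 < invCoeff G 0 0 y := hP.diag_pos
  have hdet := hP.det_pos
  have hsymm : invCoeff G 1 0 y = invCoeff G 0 1 y := hP.isHermitian.apply 0 1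
  have hdet' : 0 < invCoeff G 0 0 y * invCoeff G 1 1 y - invCoeff G 0 1 y * invCoeff G 1 0 y := by
    rwa [Matrix.det_fin_two] at hdet
  -- Completing the square: with `H` the Hessian and `v = g⁰⁰ e₀ + g⁰¹ e₁`, one has `g⁰⁰ tr(g⁻¹ H) =
  -- H(v, v) + det(g⁻¹) H(e₁, e₁)`.
  have hv := hmax.fderiv_fderiv_nonpos hf
    (invCoeff G 0 0 y • basisVec 0 + invCoeff G 0 1 y • basisVec 1)
  have hw := hmax.fderiv_fderiv_nonpos hf (basisVec 1)
  simp only [map_add, map_smul, add_apply, smul_apply,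
    smul_eq_mul, ← h2] at hv hw
  simp only [laplacianCoord, h1, Fin.sum_univ_two, mul_zero, add_zero, sub_zero]
  rw [hsymm] at hdet' ⊢
  refine nonpos_of_mul_nonpos_right ?_ ha
  nlinarith [mul_nonpos_of_nonneg_of_nonpos hdet'.le hw]

end Coordinates

/-! ### The barrier and its normal derivative -/

section Barrier

/-- A positive function whose logarithmic outer normal derivative along `y 0 = 0` is large
when `A` is large. -/
noncomputable def barrier (A B : ℝ) (y₀ y : Plane) : ℝ :=
  Real.exp (Real.exp (-A * y 0) + B * ‖y - y₀‖ ^ 2)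

variable {A B : ℝ} {y₀ y : Plane}

lemma barrier_pos : 0 < barrier A B y₀ y := Real.exp_pos _

lemma contDiff_coord (i : Fin 2) {n : WithTop ℕ∞} : ContDiff ℝ n fun y : Plane => y i :=
  (EuclideanSpace.proj (𝕜 := ℝ) i).contDiff

lemma contDiff_barrier {n : WithTop ℕ∞} : ContDiff ℝ n (barrier A B y₀) :=
  ((contDiff_const.mul (contDiff_coord 0)).exp.add
    (contDiff_const.mul ((contDiff_id.sub contDiff_const).norm_sq ℝ))).exp

lemma pderiv_barrier (hy : y ∈ range (𝓡∂ 2)) (i : Fin 2) :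
    pderiv i (barrier A B y₀) y = barrier A B y₀ y *
      (-A * Real.exp (-A * y 0) * basisVec i 0 + 2 * B * (y i - y₀ i)) := by
  have h1 : HasFDerivAt (fun y : Plane => y 0) (EuclideanSpace.proj (𝕜 := ℝ) (0 : Fin 2)) y :=
    (EuclideanSpace.proj (𝕜 := ℝ) (0 : Fin 2)).hasFDerivAt
  have h2 := ((hasFDerivAt_id y).sub_const y₀).norm_sq
  have h3 := ((h1.const_mul (-A)).exp.add (h2.const_mul B)).exp
  have h4 : HasFDerivAt (barrier A B y₀) _ y := h3
  rw [pderiv, h4.hasFDerivWithinAt.fderivWithin ((𝓡∂ 2).uniqueDiffOn y hy)]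
  simp [barrier, basisVec, EuclideanSpace.inner_single_right]
  split_ifs <;> ring

/-- Where `y 0 = 0`, the logarithmic normal derivative of the barrier is `A √g⁰⁰` plus a term
independent of `A`. Since `√g⁰⁰` is continuous and positive on the compact set, a large `A`
dominates. -/
lemma exists_barrier {G : Plane → Matrix (Fin 2) (Fin 2) ℝ} {K : Set Plane} (hK : IsCompact K)
    (hKr : K ⊆ range (𝓡∂ 2))
    (hG : ∀ y ∈ K, ∀ i j, ContDiffWithinAt ℝ 1 (fun z => G z i j) (range (𝓡∂ 2)) y)
    (hpos : ∀ y ∈ K, (G y).PosDef) (B C : ℝ) (y₀ : Plane) :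
    ∃ A, 0 ≤ A ∧ ∀ y ∈ K, y 0 = 0 →
      C * barrier A B y₀ y < normalDerivCoord G (barrier A B y₀) y := by
  have hinv : ∀ i j, ContinuousOn (invCoeff G i j) K := fun i j y hy =>
    ((ContDiffWithinAt.invCoeff (hG y hy) (hpos y hy).det_pos.ne' i j).continuousWithinAt).mono hKr
  have h00 : ∀ y ∈ K, 0 < invCoeff G 0 0 y := fun y hy => (hpos y hy).inv.diag_pos
  have hsqrt : ContinuousOn (fun y => √(invCoeff G 0 0 y)) K := (hinv 0 0).sqrt
  have hn : ∀ i, ContinuousOn (outerNormalCoord G i) K := fun i =>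
    (hinv i 0).neg.div hsqrt fun y hy => (Real.sqrt_pos.2 (h00 y hy)).ne'
  have hc : ∀ i : Fin 2, Continuous fun y : Plane => y i := fun i =>
    (contDiff_coord (n := 0) i).continuous
  have hq : ContinuousOn (fun y => (C - ∑ i, outerNormalCoord G i y * (2 * B * (y i - y₀ i))) /
      √(invCoeff G 0 0 y)) K := by
    refine ContinuousOn.div (continuousOn_const.sub (continuousOn_finsetSum _ fun i _ =>
      (hn i).mul ?_)) hsqrt fun y hy => (Real.sqrt_pos.2 (h00 y hy)).ne'
    exact (continuous_const.mul ((hc i).sub continuous_const)).continuousOn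
  obtain ⟨a, ha⟩ := hK.bddAbove_image hq
  refine ⟨|a| + 1, by positivity, fun y hy hy0 => ?_⟩
  have hs := Real.sqrt_pos.2 (h00 y hy)
  have h1 : (C - ∑ i, outerNormalCoord G i y * (2 * B * (y i - y₀ i))) / √(invCoeff G 0 0 y)
      < |a| + 1 := by
    linarith [ha (mem_image_of_mem _ hy), le_abs_self a]
  rw [div_lt_iff₀ hs] at h1
  have hn0 : outerNormalCoord G 0 y = -√(invCoeff G 0 0 y) := by
    rw [outerNormalCoord, neg_div, Real.div_sqrt]
  simp only [normalDerivCoord, pderiv_barrier (hKr hy), Fin.sum_univ_two] at h1 ⊢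
  have e0 : basisVec 0 0 = 1 := by simp [basisVec]
  have e1 : basisVec 1 0 = 0 := by simp [basisVec]
  rw [e0, e1, hy0]
  rw [hy0] at h1
  simp only [mul_zero, Real.exp_zero, zero_add, mul_one]
  have := mul_lt_mul_of_pos_left h1 (barrier_pos (A := |a| + 1) (B := B) (y₀ := y₀) (y := y))
  rw [hn0] at this ⊢
  linarith

end Barrier

/-! ### Pointwise inequalities extracted from the problem -/

section RealInequalities

/-- After replacing `ψ₁` by `ψ₂`, factor out `exp a` and use `0 ≤ 1 - exp (b - a) ≤ a - b`. -/
lemma boundary_inequality {ψ₁ ψ₂ a b C : ℝ} (hψ : ψ₁ ≤ ψ₂) (hab : b ≤ a)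
    (hC : |ψ₂| * Real.exp a ≤ C) :
    ψ₁ * Real.exp a - ψ₂ * Real.exp b ≤ C * (a - b) := by
  have h1 : Real.exp b = Real.exp a * Real.exp (b - a) := by rw [← Real.exp_add]; ring_nf
  have h2 : 1 - Real.exp (b - a) ≤ a - b := by linarith [Real.add_one_le_exp (b - a)]
  have h3 : 0 ≤ 1 - Real.exp (b - a) := by
    linarith [Real.exp_le_one_iff.2 (sub_nonpos.2 hab)]
  have h4 : 0 ≤ a - b := sub_nonneg.2 hab
  have ha := Real.exp_pos a
  calc ψ₁ * Real.exp a - ψ₂ * Real.exp b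
      ≤ ψ₂ * Real.exp a - ψ₂ * Real.exp b := by gcongr
    _ = ψ₂ * (Real.exp a * (1 - Real.exp (b - a))) := by rw [h1]; ring
    _ ≤ |ψ₂| * (Real.exp a * (1 - Real.exp (b - a))) := by gcongr; exact le_abs_self _
    _ ≤ |ψ₂| * (Real.exp a * (a - b)) := by gcongr
    _ = |ψ₂| * Real.exp a * (a - b) := by ring
    _ ≤ C * (a - b) := by gcongr

/-- Here `a, b` stand for `u₁, u₂`, `a', b'` for their time derivatives and `L₁, L₂` for their
Laplacians. Write `exp (-2b) L₂ = exp (-2b) L₁ - exp (-2b) (L₁ - L₂)` and bound `exp (-2b) L₁` below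
by `exp (2(a - b)) (a' + 1)`. The nonlinearity then costs only a bound on `a'`, and `L₁` itself
needs none. -/
lemma interior_inequality {a b a' b' L₁ L₂ C₁ C₂ C₃ : ℝ} (hab : b ≤ a)
    (ha : a' ≤ Real.exp (-2 * a) * L₁ - 1) (hb : Real.exp (-2 * b) * L₂ - 1 ≤ b')
    (hL : L₁ - L₂ ≤ C₃ * (a - b)) (hC₁ : |a' + 1| * (2 * Real.exp (2 * (a - b))) ≤ C₁)
    (hC₂ : Real.exp (-2 * b) ≤ C₂) (hC₃ : 0 ≤ C₃) :
    a' - b' ≤ (C₁ + C₂ * C₃) * (a - b) := by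
  have hw : 0 ≤ a - b := by linarith
  have h1 : Real.exp (-2 * b) = Real.exp (2 * (a - b)) * Real.exp (-2 * a) := by
    rw [← Real.exp_add]; ring_nf
  have h2 : Real.exp (2 * (a - b)) * (a' + 1) ≤ Real.exp (-2 * b) * L₁ := by
    rw [h1, mul_assoc]
    gcongr
    linarith
  have h3 : Real.exp (-2 * b) * (L₁ - L₂) ≤ C₂ * (C₃ * (a - b)) :=
    (mul_le_mul_of_nonneg_left hL (Real.exp_pos _).le).trans (by gcongr)
  have h4 : Real.exp (2 * (a - b)) - 1 ≤ 2 * (a - b) * Real.exp (2 * (a - b)) := by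
    have h5 := Real.add_one_le_exp (-(2 * (a - b)))
    have h6 : Real.exp (-(2 * (a - b))) * Real.exp (2 * (a - b)) = 1 := by
      rw [← Real.exp_add]; simp
    nlinarith [Real.exp_pos (2 * (a - b))]
  have h7 : 0 ≤ Real.exp (2 * (a - b)) - 1 := by
    linarith [Real.add_one_le_exp (2 * (a - b))]
  have h8 : (a' + 1) * (1 - Real.exp (2 * (a - b))) ≤ C₁ * (a - b) :=
    calc (a' + 1) * (1 - Real.exp (2 * (a - b)))
        = -(a' + 1) * (Real.exp (2 * (a - b)) - 1) := by ring
      _ ≤ |a' + 1| * (Real.exp (2 * (a - b)) - 1) := by gcongr; exact neg_le_abs _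
      _ ≤ |a' + 1| * (2 * (a - b) * Real.exp (2 * (a - b))) := by gcongr
      _ = |a' + 1| * (2 * Real.exp (2 * (a - b))) * (a - b) := by ring
      _ ≤ C₁ * (a - b) := by gcongr
  linarith

lemma derivWithin_nonneg_of_max_at_right {f : ℝ → ℝ} {f' t : ℝ} (ht : 0 < t)
    (hf : HasDerivWithinAt f f' (Icc 0 t) t) (hmax : ∀ s ∈ Icc 0 t, f s ≤ f t) : 0 ≤ f' := by
  have hm : IsLocalMaxOn f (Icc 0 t) t := eventually_nhdsWithin_of_forall hmax
  have hcone : -t ∈ posTangentConeAt (Icc 0 t) t := by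
    apply mem_posTangentConeAt_of_segment_subset
    rw [add_neg_cancel, segment_symm, segment_eq_Icc ht.le]
  have := hm.hasFDerivWithinAt_nonpos hf.hasFDerivWithinAt hcone
  simp at this
  exact nonneg_of_mul_nonneg_right this ht

end RealInequalities

/-! ### Excluding a touching point within one chart -/

section Comparison

variable {M : Type*} [TopologicalSpace M] [ChartedSpace (EuclideanHalfSpace 2) M]
  [IsManifold (𝓡∂ 2) ∞ M]

lemma Icc_subset_timeInterval {T : EReal} {t₀ : ℝ} (ht₀ : t₀ ∈ timeInterval T) :
    Icc 0 t₀ ⊆ timeInterval T := fun _ ht =>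
  ⟨ht.1, (EReal.coe_le_coe_iff.2 ht.2).trans_lt ht₀.2⟩

lemma symm_mem_boundary (c : M) {y : Plane} (hy : y ∈ (extChartAt (𝓡∂ 2) c).target)
    (hy0 : y 0 = 0) : (extChartAt (𝓡∂ 2) c).symm y ∈ (𝓡∂ 2).boundary M := by
  have hs := (extChartAt (𝓡∂ 2) c).map_target hy
  rw [extChartAt_source] at hs
  refine (ModelWithCorners.isBoundaryPoint_iff_of_mem_atlas (n := ∞) (by simp)
    (chart_mem_atlas _ c) hs).2 ?_
  have hyt : ((chartAt (EuclideanHalfSpace 2) c).extend (𝓡∂ 2))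
      ((extChartAt (𝓡∂ 2) c).symm y) = y := (extChartAt (𝓡∂ 2) c).right_inv hy
  rw [hyt]
  refine ⟨subset_closure hy, fun hint => ?_⟩
  have h2 := interior_mono (extChartAt_target_subset_range c) hint
  rw [interior_range_modelWithCornersEuclideanHalfSpace] at h2
  exact absurd hy0 (ne_of_gt h2)

lemma contDiffWithinAt_coordExpr {f : M → ℝ} (hf : ContMDiff (𝓡∂ 2) 𝓘(ℝ, ℝ) 2 f) (c : M)
    {y : Plane} (hy : y ∈ (extChartAt (𝓡∂ 2) c).target) :
    ContDiffWithinAt ℝ 2 (coordExpr c f) (range (𝓡∂ 2)) y := by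
  have : ContMDiffOn 𝓘(ℝ, Plane) 𝓘(ℝ, ℝ) 2 (coordExpr c f) (extChartAt (𝓡∂ 2) c).target :=
    hf.comp_contMDiffOn (contMDiffOn_extChartAt_symm c)
  exact ((contMDiffOn_iff_contDiffOn.1 this) y hy).mono_of_mem_nhdsWithin
    (extChartAt_target_mem_nhdsWithin_of_mem hy)

variable {h : Metric M} {T : EReal} {ψ₁ ψ₂ : M → ℝ → ℝ} {u₀₁ u₀₂ : M → ℝ} {u₁ u₂ : M → ℝ → ℝ}

lemma not_touching_of_boundary (h₁ : IsSubsolution h T ψ₁ u₀₁ u₁)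
    (h₂ : IsSupersolution h T ψ₂ u₀₂ u₂)
    (hψ : ∀ p ∈ (𝓡∂ 2).boundary M, ∀ t ∈ timeInterval T, ψ₁ p t ≤ ψ₂ p t)
    {c : M} {y : Plane} (hy : y ∈ (extChartAt (𝓡∂ 2) c).target) (hy0 : y 0 = 0) {t : ℝ}
    (ht : t ∈ timeInterval T) {g : Plane → ℝ} {κ C : ℝ} (hκ : 0 < κ) (hgpos : 0 < g y)
    (hg : ContDiffWithinAt ℝ 2 g (range (𝓡∂ 2)) y)
    (hgn : C * g y < normalDerivCoord (metricCoeff h c) g y)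
    (hC : |ψ₂ ((extChartAt (𝓡∂ 2) c).symm y) t| *
      Real.exp (u₁ ((extChartAt (𝓡∂ 2) c).symm y) t) ≤ C)
    (heq : u₁ ((extChartAt (𝓡∂ 2) c).symm y) t - u₂ ((extChartAt (𝓡∂ 2) c).symm y) t = κ * g y)
    (hmax : IsLocalMaxOn (fun z => coordExpr c (fun p => u₁ p t) z -
      coordExpr c (fun p => u₂ p t) z - κ * g z) (range (𝓡∂ 2)) y) : False := by
  have hyr := extChartAt_target_subset_range c hy
  have hs := (extChartAt (𝓡∂ 2) c).map_target hy
  rw [extChartAt_source] at hs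
  have hb := symm_mem_boundary c hy hy0
  have d : ∀ {f : Plane → ℝ}, ContDiffWithinAt ℝ 2 f (range (𝓡∂ 2)) y →
      DifferentiableWithinAt ℝ f (range (𝓡∂ 2)) y := fun hf => hf.differentiableWithinAt (by simp)
  have d₁ := d (contDiffWithinAt_coordExpr (h₁.regular.contMDiff_space t ht) c hy)
  have d₂ := d (contDiffWithinAt_coordExpr (h₂.regular.contMDiff_space t ht) c hy)
  have h0 := normalDerivCoord_nonneg_of_isLocalMaxOn (G := metricCoeff h c) hmax hyr
    ((posDef_metricCoeff h c hy).inv.diag_pos (i := 0)).le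
  rw [normalDerivCoord_sub (d₁.fun_sub d₂) ((d hg).const_mul κ) hyr, normalDerivCoord_sub d₁ d₂ hyr,
    normalDerivCoord_const_mul (d hg) hyr] at h0
  have b₁ := h₁.boundary c _ hs hb t ht
  have b₂ := h₂.boundary c _ hs hb t ht
  simp only [normalDeriv, (extChartAt (𝓡∂ 2) c).right_inv hy] at b₁ b₂
  have hle : u₂ ((extChartAt (𝓡∂ 2) c).symm y) t ≤ u₁ ((extChartAt (𝓡∂ 2) c).symm y) t := by
    nlinarith
  -- Subtracting `b₂` from `b₁` cancels the geodesic curvature, so `key` bounds the normal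
  -- derivative of `u₁ - u₂` by `C κ g`, against `hgn`.
  have key := boundary_inequality (hψ _ hb t ht) hle hC
  rw [heq] at key
  have := mul_lt_mul_of_pos_left hgn hκ
  linarith

lemma not_touching_of_interior (h₁ : IsSubsolution h T ψ₁ u₀₁ u₁)
    (h₂ : IsSupersolution h T ψ₂ u₀₂ u₂)
    {c : M} {y : Plane} (hy : y ∈ (extChartAt (𝓡∂ 2) c).target) (hy0 : 0 < y 0) {t : ℝ}
    (ht : t ∈ timeInterval T) (htpos : 0 < t) {g : Plane → ℝ} {κ μ C₁ C₂ C₃ : ℝ} (hκ : 0 < κ)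
    (hgpos : 0 < g y) (hg : ContDiffWithinAt ℝ 2 g (range (𝓡∂ 2)) y)
    (hC₁ : |timeDeriv T u₁ ((extChartAt (𝓡∂ 2) c).symm y) t + 1| *
      (2 * Real.exp (2 * (u₁ ((extChartAt (𝓡∂ 2) c).symm y) t -
        u₂ ((extChartAt (𝓡∂ 2) c).symm y) t))) ≤ C₁)
    (hC₂ : Real.exp (-2 * u₂ ((extChartAt (𝓡∂ 2) c).symm y) t) ≤ C₂) (hC₃ : 0 ≤ C₃)
    (hgl : laplacianCoord (metricCoeff h c) g y ≤ C₃ * g y) (hμ : C₁ + C₂ * C₃ < μ)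
    (heq : u₁ ((extChartAt (𝓡∂ 2) c).symm y) t - u₂ ((extChartAt (𝓡∂ 2) c).symm y) t
      = κ * Real.exp (μ * t) * g y)
    (hmax : IsLocalMaxOn (fun z => coordExpr c (fun p => u₁ p t) z -
      coordExpr c (fun p => u₂ p t) z - κ * Real.exp (μ * t) * g z) (range (𝓡∂ 2)) y)
    (htime : ∀ s ∈ Icc 0 t, u₁ ((extChartAt (𝓡∂ 2) c).symm y) s -
      u₂ ((extChartAt (𝓡∂ 2) c).symm y) s ≤ κ * Real.exp (μ * s) * g y) : False := by
  have hyr := extChartAt_target_subset_range c hy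
  have hs := (extChartAt (𝓡∂ 2) c).map_target hy
  rw [extChartAt_source] at hs
  have d₁ := contDiffWithinAt_coordExpr (h₁.regular.contMDiff_space t ht) c hy
  have d₂ := contDiffWithinAt_coordExpr (h₂.regular.contMDiff_space t ht) c hy
  have hnhds : range (𝓡∂ 2) ∈ 𝓝 y := by
    rw [← mem_interior_iff_mem_nhds, interior_range_modelWithCornersEuclideanHalfSpace]
    exact hy0
  have hw : 0 < κ * Real.exp (μ * t) * g y := by positivity
  have h0 := laplacianCoord_nonpos_of_isLocalMaxOn (G := metricCoeff h c) hmax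
    ((d₁.sub d₂).sub (contDiffWithinAt_const.mul hg)) hnhds (posDef_metricCoeff h c hy)
  rw [laplacianCoord_sub (d₁.sub d₂) (contDiffWithinAt_const.mul hg) hyr,
    laplacianCoord_sub d₁ d₂ hyr, laplacianCoord_const_mul hg hyr] at h0
  have e₁ := h₁.equation c _ hs t ht
  have e₂ := h₂.equation c _ hs t ht
  simp only [laplacian, (extChartAt (𝓡∂ 2) c).right_inv hy] at e₁ e₂
  have key := interior_inequality (by linarith) e₁ e₂ (C₃ := C₃) (by
    rw [heq]
    have := mul_le_mul_of_nonneg_left hgl (by positivity : 0 ≤ κ * Real.exp (μ * t))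
    linarith) hC₁ hC₂ hC₃
  set p := (extChartAt (𝓡∂ 2) c).symm y
  have hd : ∀ {u : M → ℝ → ℝ}, IsC21 T u → HasDerivWithinAt (u p) (timeDeriv T u p t) (Icc 0 t) t :=
    fun hu => (hu.differentiable_time p t ht).hasDerivWithinAt.mono (Icc_subset_timeInterval ht)
  have hexp : HasDerivWithinAt (fun s => κ * Real.exp (μ * s) * g y)
      (κ * (Real.exp (μ * t) * μ) * g y) (Icc 0 t) t := by
    have : HasDerivAt (fun s => μ * s) μ t := by simpa using (hasDerivAt_id t).const_mul μ
    exact ((this.exp.const_mul κ).mul_const (g y)).hasDerivWithinAt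
  -- Only times up to `t` are compared, so a one-sided derivative from the left suffices, even at
  -- the final time.
  have hnn := derivWithin_nonneg_of_max_at_right htpos
    (((hd h₁.regular).sub (hd h₂.regular)).sub hexp) (fun s hs => by
      have := htime s hs
      simp only [Pi.sub_apply]
      linarith)
  rw [heq] at key
  have := mul_lt_mul_of_pos_right hμ hw
  linarith

/-- Collects the compactness constants of one chart. Any `μ` beyond the threshold works, so one `μ`
can serve finitely many charts. -/
lemma exists_chart_barrier (h₁ : IsSubsolution h T ψ₁ u₀₁ u₁)
    (h₂ : IsSupersolution h T ψ₂ u₀₂ u₂)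
    (hψ₂ : ContinuousOn (fun q : M × ℝ => ψ₂ q.1 q.2) ((𝓡∂ 2).boundary M ×ˢ timeInterval T))
    (hψ : ∀ p ∈ (𝓡∂ 2).boundary M, ∀ t ∈ timeInterval T, ψ₁ p t ≤ ψ₂ p t)
    {t₀ : ℝ} (ht₀ : t₀ ∈ timeInterval T) (c : M) :
    ∃ r > 0, Metric.closedBall (extChartAt (𝓡∂ 2) c c) r ∩ range (𝓡∂ 2) ⊆
        (extChartAt (𝓡∂ 2) c).target ∧
      ∃ A ≥ 0, ∃ Λ, ∀ μ > Λ,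
        ∀ y ∈ Metric.closedBall (extChartAt (𝓡∂ 2) c c) r ∩ range (𝓡∂ 2), ∀ t ∈ Ioc 0 t₀, ∀ κ > 0,
        u₁ ((extChartAt (𝓡∂ 2) c).symm y) t - u₂ ((extChartAt (𝓡∂ 2) c).symm y) t
          = κ * Real.exp (μ * t) * barrier A (2 / r ^ 2) (extChartAt (𝓡∂ 2) c c) y →
        IsLocalMaxOn (fun z => coordExpr c (fun p => u₁ p t) z - coordExpr c (fun p => u₂ p t) z -
          κ * Real.exp (μ * t) * barrier A (2 / r ^ 2) (extChartAt (𝓡∂ 2) c c) z)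
          (range (𝓡∂ 2)) y →
        ¬ ∀ s ∈ Icc 0 t, u₁ ((extChartAt (𝓡∂ 2) c).symm y) s -
          u₂ ((extChartAt (𝓡∂ 2) c).symm y) s
            ≤ κ * Real.exp (μ * s) * barrier A (2 / r ^ 2) (extChartAt (𝓡∂ 2) c c) y := by
  have hI := Icc_subset_timeInterval ht₀
  obtain ⟨r, hr, hrt⟩ : ∃ r > 0, Metric.closedBall (extChartAt (𝓡∂ 2) c c) r ∩ range (𝓡∂ 2) ⊆
      (extChartAt (𝓡∂ 2) c).target :=
    (Metric.nhds_basis_closedBall.mem_iff.1 (mem_nhdsWithin_iff_exists_mem_nhds_inter.1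
      (extChartAt_target_mem_nhdsWithin c)).choose_spec.1).imp fun r hr => ⟨hr.1,
      (inter_subset_inter_left _ hr.2).trans (mem_nhdsWithin_iff_exists_mem_nhds_inter.1
      (extChartAt_target_mem_nhdsWithin c)).choose_spec.2⟩
  refine ⟨r, hr, hrt, ?_⟩
  set y₀ := extChartAt (𝓡∂ 2) c c
  set K := Metric.closedBall y₀ r ∩ range (𝓡∂ 2)
  have hclosed : IsClosed (range (𝓡∂ 2)) := (𝓡∂ 2).isClosed_range
  have hK : IsCompact K := (isCompact_closedBall y₀ r).inter_right hclosed
  have hKr : K ⊆ range (𝓡∂ 2) := inter_subset_right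
  have hG : ∀ y ∈ K, ∀ i j,
      ContDiffWithinAt ℝ 1 (fun z => metricCoeff h c z i j) (range (𝓡∂ 2)) y := fun y hy i j =>
    ((contDiffOn_metricCoeff h c i j y (hrt hy)).of_le one_le_two).mono_of_mem_nhdsWithin
      (extChartAt_target_mem_nhdsWithin_of_mem (hrt hy))
  have hpos : ∀ y ∈ K, (metricCoeff h c y).PosDef := fun y hy => posDef_metricCoeff h c (hrt hy)
  have hΦ : ContinuousOn (fun q : Plane × ℝ => ((extChartAt (𝓡∂ 2) c).symm q.1, q.2))
      (K ×ˢ Icc 0 t₀) :=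
    (((continuousOn_extChartAt_symm c).mono hrt).comp continuousOn_fst fun q hq => hq.1).prodMk
      continuousOn_snd
  have hΦu : MapsTo (fun q : Plane × ℝ => ((extChartAt (𝓡∂ 2) c).symm q.1, q.2))
      (K ×ˢ Icc 0 t₀) (univ ×ˢ timeInterval T) := fun q hq => ⟨mem_univ _, hI hq.2⟩
  have cu₁ := h₁.regular.continuous.comp hΦ hΦu
  have cu₂ := h₂.regular.continuous.comp hΦ hΦu
  have cd₁ := h₁.regular.continuous_timeDeriv.comp hΦ hΦu
  have hKI : IsCompact (K ×ˢ Icc 0 t₀) := hK.prod isCompact_Icc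
  obtain ⟨C₁, hC₁⟩ := hKI.bddAbove_image ((cd₁.add (continuousOn_const (c := (1 : ℝ)))).abs.mul
    ((((cu₁.sub cu₂).const_smul (2 : ℝ)).rexp).const_smul (2 : ℝ)))
  obtain ⟨C₂, hC₂⟩ := hKI.bddAbove_image ((cu₂.const_smul (-2 : ℝ)).rexp)
  have hK0 : IsCompact (K ∩ {y | y 0 = 0}) :=
    hK.inter_right (isClosed_eq (contDiff_coord (n := 0) 0).continuous continuous_const)
  have hsub0 : (K ∩ {y | y 0 = 0}) ×ˢ Icc 0 t₀ ⊆ K ×ˢ Icc 0 t₀ :=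
    prod_mono inter_subset_left subset_rfl
  have cψ := hψ₂.comp (hΦ.mono hsub0) fun q hq =>
    ⟨symm_mem_boundary c (hrt hq.1.1) hq.1.2, hI hq.2⟩
  obtain ⟨C, hC⟩ := (hK0.prod isCompact_Icc).bddAbove_image (cψ.abs.mul (cu₁.mono hsub0).rexp)
  -- `A` is fixed before `C₃`, which depends on it through the barrier.
  obtain ⟨A, hA, hAn⟩ := exists_barrier hK hKr hG hpos (2 / r ^ 2) C y₀
  have hgC : ∀ y, ContDiffWithinAt ℝ 2 (barrier A (2 / r ^ 2) y₀) (range (𝓡∂ 2)) y :=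
    fun y => contDiff_barrier.contDiffAt.contDiffWithinAt
  have hlap : ContinuousOn (fun y => laplacianCoord (metricCoeff h c) (barrier A (2 / r ^ 2) y₀) y /
      barrier A (2 / r ^ 2) y₀ y) K := by
    refine ContinuousOn.div (fun y hy => ?_) (contDiff_barrier (n := 0)).continuous.continuousOn
      fun y _ => barrier_pos.ne'
    exact (continuousWithinAt_laplacianCoord (hG y hy) (hpos y hy).det_pos.ne' (hgC y)
      (hKr hy)).mono hKr
  obtain ⟨C₃, hC₃⟩ := hK.bddAbove_image hlap
  refine ⟨A, hA, C₁ + C₂ * |C₃|, fun μ hμ y hy t ht κ hκ heq hmax htime => ?_⟩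
  have ht' : t ∈ Icc 0 t₀ := ⟨ht.1.le, ht.2⟩
  have hy0 : 0 ≤ y 0 := by
    have := hKr hy
    rwa [range_halfPlane] at this
  rcases hy0.eq_or_lt with hy0 | hy0
  · exact not_touching_of_boundary h₁ h₂ hψ (hrt hy) hy0.symm (hI ht') (by positivity) barrier_pos
      (hgC y) (hAn y hy hy0.symm) (hC (mem_image_of_mem _ (mk_mem_prod (mem_inter hy hy0.symm) ht')))
      heq hmax
  · refine not_touching_of_interior h₁ h₂ (hrt hy) hy0 (hI ht') ht.1 hκ barrier_pos (hgC y)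
      (hC₁ (mem_image_of_mem _ (mk_mem_prod hy ht')))
      (hC₂ (mem_image_of_mem _ (mk_mem_prod hy ht'))) (abs_nonneg C₃) ?_ hμ heq hmax htime
    rw [← div_le_iff₀ barrier_pos]
    exact (hC₃ (mem_image_of_mem _ hy)).trans (le_abs_self _)

end Comparison

/-! ### Separation of the barrier between centre and rim -/

section Barrier

variable {A r : ℝ} {y₀ y : Plane}

/-- With coefficient `2 / r ^ 2` the quadratic term is below `1` within distance `r / 2` and at
least `2` from distance `r` on, while `exp (-A y 0)` lies in `(0, 1]`. The level `exp 2` depends on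
neither `A` nor `r`, so barriers of different charts can be compared. -/
lemma barrier_lt_exp_two (hA : 0 ≤ A) (hr : 0 < r) (hy : 0 ≤ y 0) (hd : dist y y₀ < r / 2) :
    barrier A (2 / r ^ 2) y₀ y < Real.exp 2 := by
  rw [barrier, Real.exp_lt_exp, ← dist_eq_norm]
  have h1 : Real.exp (-A * y 0) ≤ 1 := Real.exp_le_one_iff.2 (by nlinarith)
  have h2 : 2 / r ^ 2 * dist y y₀ ^ 2 < 1 := by
    rw [div_mul_eq_mul_div, div_lt_one (by positivity)]
    nlinarith [dist_nonneg (x := y) (y := y₀)]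
  linarith

lemma exp_two_le_barrier (hr : 0 < r) (hd : r ≤ dist y y₀) :
    Real.exp 2 ≤ barrier A (2 / r ^ 2) y₀ y := by
  rw [barrier, Real.exp_le_exp, ← dist_eq_norm]
  have h2 : 2 ≤ 2 / r ^ 2 * dist y y₀ ^ 2 := by
    rw [div_mul_eq_mul_div, le_div_iff₀ (by positivity)]
    gcongr
  linarith [Real.exp_pos (-A * y 0)]

end Barrier

/-! ### The global maximum argument -/

section Comparison

variable {M : Type*} [TopologicalSpace M] [ChartedSpace (EuclideanHalfSpace 2) M]
  [IsManifold (𝓡∂ 2) ∞ M]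
variable {h : Metric M} {T : EReal} {ψ₁ ψ₂ : M → ℝ → ℝ} {u₀₁ u₀₂ : M → ℝ} {u₁ u₂ : M → ℝ → ℝ}

/-- A subsolution stays below a supersolution with larger boundary and initial data. -/
theorem IsSubsolution.le_supersolution [CompactSpace M] (h₁ : IsSubsolution h T ψ₁ u₀₁ u₁)
    (h₂ : IsSupersolution h T ψ₂ u₀₂ u₂)
    (hψ₂ : ContinuousOn (fun q : M × ℝ => ψ₂ q.1 q.2) ((𝓡∂ 2).boundary M ×ˢ timeInterval T))
    (hψ : ∀ p ∈ (𝓡∂ 2).boundary M, ∀ t ∈ timeInterval T, ψ₁ p t ≤ ψ₂ p t)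
    (hu₀ : ∀ p, u₀₁ p ≤ u₀₂ p) (p₀ : M) {t₀ : ℝ} (ht₀ : t₀ ∈ timeInterval T) :
    u₁ p₀ t₀ ≤ u₂ p₀ t₀ := by
  by_contra! hlt
  choose r hr hrt A hA Λ hΛ using exists_chart_barrier h₁ h₂ hψ₂ hψ ht₀
  set e : M → PartialEquiv M Plane := fun c => extChartAt (𝓡∂ 2) c
  set K : M → Set Plane := fun c => Metric.closedBall (e c c) (r c) ∩ range (𝓡∂ 2)
  set g : M → Plane → ℝ := fun c => barrier (A c) (2 / r c ^ 2) (e c c)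
  have hgpos : ∀ c y, 0 < g c y := fun c y => barrier_pos
  obtain ⟨S, hS⟩ : ∃ S : Finset M, ∀ p, ∃ c ∈ S, p ∈ (e c).source ∧
      dist (e c p) (e c c) < r c / 2 := by
    obtain ⟨S, -, hS⟩ := isCompact_univ.elim_nhds_subcover
      (fun c => {p | p ∈ (e c).source ∧ dist (e c p) (e c c) < r c / 2}) fun c _ =>
        Filter.inter_mem (extChartAt_source_mem_nhds (I := 𝓡∂ 2) c)
          ((continuousAt_extChartAt c).preimage_mem_nhds (Metric.ball_mem_nhds _ (half_pos (hr c))))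
    exact ⟨S, fun p => by simpa [and_left_comm] using hS (mem_univ p)⟩
  have hmemK : ∀ c p, p ∈ (e c).source → dist (e c p) (e c c) < r c / 2 → e c p ∈ K c :=
    fun c p hp hd => ⟨Metric.mem_closedBall.2 (by linarith [hr c]),
      extChartAt_target_subset_range c ((e c).map_source hp)⟩
  obtain ⟨μ, hμ⟩ : ∃ μ, ∀ c ∈ S, μ > Λ c := by
    obtain ⟨m, hm⟩ := (S.image Λ).exists_le
    exact ⟨m + 1, fun c hc => by linarith [hm _ (Finset.mem_image_of_mem Λ hc)]⟩
  set w : M → ℝ → ℝ := fun p t => u₁ p t - u₂ p t with hw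
  set F : M → Plane × ℝ → ℝ := fun c q =>
    w ((e c).symm q.1) q.2 / (Real.exp (μ * q.2) * g c q.1) with hF
  have hI := Icc_subset_timeInterval ht₀
  have hex : ∀ c, ∃ q ∈ K c ×ˢ Icc 0 t₀, IsMaxOn (F c) (K c ×ˢ Icc 0 t₀) q := fun c => by
    have hΦ : ContinuousOn (fun q : Plane × ℝ => ((e c).symm q.1, q.2)) (K c ×ˢ Icc 0 t₀) :=
      (((continuousOn_extChartAt_symm c).mono (hrt c)).comp continuousOn_fst
        fun q hq => hq.1).prodMk continuousOn_snd
    have hΦu : MapsTo (fun q : Plane × ℝ => ((e c).symm q.1, q.2))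
        (K c ×ˢ Icc 0 t₀) (univ ×ˢ timeInterval T) := fun q hq => ⟨mem_univ _, hI hq.2⟩
    refine IsCompact.exists_isMaxOn ?_ ?_ ?_
    · exact ((isCompact_closedBall _ _).inter_right (𝓡∂ 2).isClosed_range).prod isCompact_Icc
    · exact ⟨(e c c, 0), hmemK c c (mem_extChartAt_source c) (by simpa using half_pos (hr c)),
        le_rfl, ht₀.1⟩
    · refine ((h₁.regular.continuous.comp hΦ hΦu).sub (h₂.regular.continuous.comp hΦ hΦu)).div ?_
        fun q _ => (mul_pos (Real.exp_pos _) (hgpos c _)).ne'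
      have := (contDiff_barrier (n := 0) (A := A c) (B := 2 / r c ^ 2) (y₀ := e c c)).continuous
      exact Continuous.continuousOn (by fun_prop)
  choose q hq hqmax using hex
  obtain ⟨c₀, hc₀S, hc₀, hd₀⟩ := hS p₀
  -- The best chart: `κ` bounds the quotient in every chart of the cover and is attained in chart
  -- `c`.
  obtain ⟨c, hcS, hc⟩ := S.exists_max_image (fun c => F c (q c)) ⟨c₀, hc₀S⟩
  set y := (q c).1
  set t := (q c).2
  set κ := F c (q c)
  have hle : ∀ c' ∈ S, ∀ y' ∈ K c', ∀ s ∈ Icc 0 t₀, F c' (y', s) ≤ κ := fun c' hc' y' hy' s hs =>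
    (hqmax c' (mk_mem_prod hy' hs)).trans (hc c' hc')
  have hκ : 0 < κ := by
    refine lt_of_lt_of_le ?_ (hle c₀ hc₀S _ (hmemK c₀ p₀ hc₀ hd₀) t₀ ⟨ht₀.1, le_rfl⟩)
    simp only [hF, (e c₀).left_inv hc₀, hw]
    exact div_pos (sub_pos.2 hlt) (mul_pos (Real.exp_pos _) (hgpos _ _))
  have hyK : y ∈ K c := (hq c).1
  have htI : t ∈ Icc 0 t₀ := (hq c).2
  have hden : ∀ s z, 0 < Real.exp (μ * s) * g c z := fun s z =>
    mul_pos (Real.exp_pos _) (hgpos _ _)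
  have heq : w ((e c).symm y) t = κ * (Real.exp (μ * t) * g c y) :=
    (div_eq_iff (hden t y).ne').1 rfl
  have hwpos : 0 < w ((e c).symm y) t := heq ▸ mul_pos hκ (hden t y)
  have hwle : ∀ z ∈ K c, ∀ s ∈ Icc 0 t₀,
      w ((e c).symm z) s ≤ κ * (Real.exp (μ * s) * g c z) := fun z hz s hs =>
    (div_le_iff₀ (hden s z)).1 (hle c hcS z hz s hs)
  have htpos : 0 < t := by
    refine htI.1.lt_of_ne fun h0 => hwpos.not_ge ?_
    rw [← h0]
    simp only [hw]
    linarith [h₁.initial ((e c).symm y), h₂.initial ((e c).symm y), hu₀ ((e c).symm y)]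
  -- On the rim, a chart containing the same point in its half-radius ball would have a smaller
  -- barrier there, hence a quotient exceeding `κ`.
  have hball : dist y (e c c) < r c := by
    by_contra! hge
    obtain ⟨c', hc'S, hc', hd'⟩ := hS ((e c).symm y)
    have hK' := hmemK c' _ hc' hd'
    have h0 : (0 : ℝ) ≤ e c' ((e c).symm y) 0 := by
      have := hK'.2
      rwa [range_halfPlane] at this
    have h1 : g c' (e c' ((e c).symm y)) < g c y :=
      (barrier_lt_exp_two (hA c') (hr c') h0 hd').trans_le (exp_two_le_barrier (hr c) hge)
    refine (hle c' hc'S _ hK' t htI).not_gt ?_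
    simp only [hF, (e c').left_inv hc']
    change w ((e c).symm y) t / (Real.exp (μ * t) * g c y) < _
    exact div_lt_div_of_pos_left hwpos (mul_pos (Real.exp_pos _) (hgpos _ _))
      (mul_lt_mul_of_pos_left h1 (Real.exp_pos _))
  refine hΛ c μ (hμ c hcS) y hyK t ⟨htpos, htI.2⟩ κ hκ (by rw [mul_assoc]; exact heq) ?_
    fun s hs => by rw [mul_assoc]; exact hwle y hyK s ⟨hs.1, hs.2.trans htI.2⟩
  -- Since `y` is off the rim, the half-ball is a neighbourhood of `y` in the half-plane, so the
  -- maximum over it is a local maximum there.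
  filter_upwards [self_mem_nhdsWithin, mem_nhdsWithin_of_mem_nhds
    (Metric.isOpen_ball.mem_nhds (Metric.mem_ball.2 hball))] with z hz hzb
  have hzw := hwle z ⟨Metric.ball_subset_closedBall hzb, hz⟩ t htI
  simp only [hw] at hzw heq
  simp only [coordExpr, mul_assoc]
  exact (sub_nonpos.2 hzw).trans (sub_nonneg.2 heq.ge)

end Comparison

/-! ### Solutions as sub- and supersolutions -/

section Solution

variable {M : Type*} [TopologicalSpace M] [ChartedSpace (EuclideanHalfSpace 2) M]
  [IsManifold (𝓡∂ 2) ∞ M] {h : Metric M} {T : EReal} {ψ : M → ℝ → ℝ} {u₀ : M → ℝ} {u : M → ℝ → ℝ}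

lemma IsSolution.isSubsolution (hu : IsSolution h T ψ u₀ u) : IsSubsolution h T ψ u₀ u :=
  ⟨hu.regular, fun c p hp t ht => (hu.equation c p hp t ht).le,
    fun c p hp hb t ht => (hu.boundary c p hp hb t ht).le, fun p => (hu.initial p).le⟩

lemma IsSolution.isSupersolution (hu : IsSolution h T ψ u₀ u) : IsSupersolution h T ψ u₀ u :=
  ⟨hu.regular, fun c p hp t ht => (hu.equation c p hp t ht).ge,
    fun c p hp hb t ht => (hu.boundary c p hp hb t ht).ge, fun p => (hu.initial p).ge⟩

end Solution

end BoundarySurface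

theorem mainTheorem3 {M : Type*} [TopologicalSpace M] [ChartedSpace (EuclideanHalfSpace 2) M]
    [IsManifold (𝓡∂ 2) ∞ M] [CompactSpace M] [T2Space M]
    (h : BoundarySurface.Metric M) (hflat : BoundarySurface.IsFlat h)
    (T : EReal) (hT : 0 < T)
    (ψ₁ ψ₂ : M → ℝ → ℝ)
    (hψ₁ : ContinuousOn (fun q : M × ℝ => ψ₁ q.1 q.2)
      ((𝓡∂ 2).boundary M ×ˢ BoundarySurface.timeInterval T))
    (hψ₂ : ContinuousOn (fun q : M × ℝ => ψ₂ q.1 q.2)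
      ((𝓡∂ 2).boundary M ×ˢ BoundarySurface.timeInterval T))
    (hψ : ∀ p ∈ (𝓡∂ 2).boundary M, ∀ t ∈ BoundarySurface.timeInterval T, ψ₁ p t ≤ ψ₂ p t)
    (u₀₁ u₀₂ : M → ℝ) (hu₀ : ∀ p, u₀₁ p ≤ u₀₂ p) (u₁ u₂ : M → ℝ → ℝ) :
    (BoundarySurface.IsSolution h T ψ₁ u₀₁ u₁ → BoundarySurface.IsSolution h T ψ₂ u₀₂ u₂ →
      ∀ p, ∀ t ∈ BoundarySurface.timeInterval T, u₁ p t ≤ u₂ p t) ∧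
    (BoundarySurface.IsSubsolution h T ψ₁ u₀₁ u₁ → BoundarySurface.IsSupersolution h T ψ₂ u₀₂ u₂ →
      ∀ p, ∀ t ∈ BoundarySurface.timeInterval T, u₁ p t ≤ u₂ p t) := by
  have key : BoundarySurface.IsSubsolution h T ψ₁ u₀₁ u₁ →
      BoundarySurface.IsSupersolution h T ψ₂ u₀₂ u₂ →
      ∀ p, ∀ t ∈ BoundarySurface.timeInterval T, u₁ p t ≤ u₂ p t :=
    fun h₁ h₂ p _ ht => h₁.le_supersolution h₂ hψ₂ hψ hu₀ p ht
  exact ⟨fun h₁ h₂ => key h₁.isSubsolution h₂.isSupersolution, key⟩
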